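/- Let $K/k$ be a finite Galois field extension whose Galois group $G$ is Hamiltonian (non-abelian, with all subgroups normal). A Hopf--Galois structure on $K/k$ is a pair $(H,\mu)$, where $H$ is a finite cocommutative $k$-Hopf algebra and $\mu:H\to\mathrm{End}_k(K)$ is a Hopf action such that the map $K\otimes_k H\to\mathrm{End}_k(K)$, $x\otimes h\mapsto(y\mapsto x\,\mu(h)(y))$, is bijective; two structures are isomorphic if some Hopf algebra isomorphism is compatible with the actions. The image of its Galois correspondence is the set of fields $K^{H'}=\{x\in K:\mu(h)(x)=\varepsilon(h)x\ \text{for all } h\in H'\}$, where $H'$ runs over the sub-Hopf algebras of $H$. In $\mathrm{Sym}(G)$ (that is, $S_n$ with $n=|G|$) let $\lambda(G)=\{\lambda_g: x\mapsto gx\}$ and $\rho(G)=\{\rho_g: x\mapsto xg^{-1}\}$. For a regular subgroup $N$ of $\mathrm{Sym}(G)$ normalized by $\lambda(G)$, let $G$ act on $N$ by $n\mapsto\lambda_g n\lambda_g^{-1}$ and on the group algebra $K[N]$ through this action and the field automorphisms of $K$. The Hopf--Galois structure associated to $N$ has Hopf algebra $K[N]^G$ (with the operations restricted from $K[N]$)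 and action $\bigl(\sum_n a_n n\bigr)\cdot x=\sum_n a_n\,(n^{-1}(1_G))(x)$. Two such subgroups are $G$-isomorphic if there is a $G$-equivariant group isomorphism between them. Then: 1. $\rho(G)$ and $\lambda(G)$ are regular subgroups of $\mathrm{Sym}(G)$ normalized by $\lambda(G)$; they are isomorphic to $G$, hence to each other, but they are not $G$-isomorphic. 2. There are Hopf--Galois structures on $K/k$ associated to $\rho(G)$ and to $\lambda(G)$. The one associated to $\rho(G)$ is the classical one: the group algebra $k[G]$ with the $k$-linear extension of the action of $G$ on $K$. 3. These two Hopf--Galois structures are not isomorphic; indeed their underlying $k$-Hopf algebras are not isomorphic. 4. For both structures the image of the Galois correspondence is the set of all intermediate fields of $K/k$. For the structure associated to $\lambda(G)$ it is also the set of intermediate fields $E$ with $E/k$ Galois. -/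

import Mathlib

open scoped TensorProduct

universe u v w

namespace HopfGalois

/-! ### Hopf Galois structures -/

/-- The `k`-linear map `K ⊗ H → End_k(K)`, `x ⊗ h ↦ (y ↦ x * μ h y)`, attached to a linear map
`μ : H → End_k(K)`. -/
noncomputable def canonicalMap {k K H : Type*} [Field k] [Field K] [Algebra k K] [Ring H]
    [Algebra k H] (μ : H →ₗ[k] Module.End k K) : K ⊗[k] H →ₗ[k] Module.End k K :=
  TensorProduct.lift
    ((LinearMap.mul k (Module.End k K)).compl₁₂ (Algebra.lmul k K).toLinearMap μ)

/-- A Hopf Galois structure `(H, μ)` on `K/k`: a finite cocommutative `k`-Hopf algebra `H` with a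
Hopf action `μ` on `K` (that is, `μ` makes `K` an `H`-module algebra) for which
`K ⊗ H → End_k(K)` is bijective. -/
structure HopfGaloisStructure.{w', u', v'} (k : Type u') (K : Type v') [Field k] [Field K]
    [Algebra k K] where
  /-- the underlying Hopf algebra -/
  H : Type w'
  [instRing : Ring H]
  [instHopf : HopfAlgebra k H]
  [instCocomm : Coalgebra.IsCocomm k H]
  [instFinite : Module.Finite k H]
  /-- the action -/
  μ : H →ₐ[k] Module.End k K
  /-- `h · 1 = ε(h) 1` -/
  act_one : ∀ h : H, μ h 1 = algebraMap k K (Coalgebra.counit h)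
  /-- `h · (x y) = ∑ (h₁ · x) (h₂ · y)` -/
  act_mul : ∀ (h : H) (x y : K), μ h (x * y) =
    LinearMap.mul' k K (TensorProduct.map (μ.toLinearMap.flip x) (μ.toLinearMap.flip y)
      (Coalgebra.comul (R := k) h))
  /-- the Galois condition -/
  bijective : Function.Bijective (canonicalMap μ.toLinearMap)

attribute [instance] HopfGaloisStructure.instRing HopfGaloisStructure.instHopf
  HopfGaloisStructure.instCocomm HopfGaloisStructure.instFinite

/-- Isomorphism of Hopf Galois structures: an isomorphism of Hopf algebras compatible with the
actions (a bialgebra isomorphism of Hopf algebras commutes with the antipodes automatically). -/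
def HopfGaloisStructure.Isomorphic {k K : Type*} [Field k] [Field K] [Algebra k K]
    (S T : HopfGaloisStructure k K) : Prop :=
  ∃ f : S.H ≃ₐc[k] T.H, ∀ h : S.H, T.μ (f h) = S.μ h

/-- A sub-Hopf algebra of a Hopf algebra `H` over a field: a subalgebra `A` with
`Δ(A) ⊆ A ⊗ A` and `S(A) ⊆ A`. -/
structure SubHopfAlgebra (k H : Type*) [Field k] [Ring H] [HopfAlgebra k H] extends
    Subalgebra k H where
  comul_mem' : ∀ h ∈ carrier, Coalgebra.comul (R := k) h ∈
    LinearMap.range (TensorProduct.map toSubalgebra.val.toLinearMap toSubalgebra.val.toLinearMap)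
  antipode_mem' : ∀ h ∈ carrier, HopfAlgebra.antipode k h ∈ carrier

section GaloisCorrespondence

variable {k K : Type*} [Field k] [Field K] [Algebra k K]

theorem HopfGaloisStructure.act_algebraMap (S : HopfGaloisStructure k K) (h : S.H) (c : k) :
    S.μ h (algebraMap k K c) = Coalgebra.counit (R := k) h • algebraMap k K c := by
  rw [Algebra.algebraMap_eq_smul_one, map_smul, S.act_one, Algebra.algebraMap_eq_smul_one,
    smul_comm]

theorem HopfGaloisStructure.act_mul_of_fixed (S : HopfGaloisStructure k K)
    (A : SubHopfAlgebra k S.H) {x y : K}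
    (hx : ∀ h ∈ A.toSubalgebra, S.μ h x = Coalgebra.counit (R := k) h • x)
    (hy : ∀ h ∈ A.toSubalgebra, S.μ h y = Coalgebra.counit (R := k) h • y) :
    ∀ h ∈ A.toSubalgebra, S.μ h (x * y) = Coalgebra.counit (R := k) h • (x * y) := by
  intro h hh
  obtain ⟨t, ht⟩ := A.comul_mem' h hh
  -- on the image of `A ⊗ A`, acting on `x` and `y` is the same as applying `ε` twice
  have key : ∀ t : A.toSubalgebra ⊗[k] A.toSubalgebra,
      LinearMap.mul' k K (TensorProduct.map (S.μ.toLinearMap.flip x) (S.μ.toLinearMap.flip y)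
        (TensorProduct.map A.toSubalgebra.val.toLinearMap A.toSubalgebra.val.toLinearMap t)) =
      (LinearMap.mul' k K) (TensorProduct.map
        (LinearMap.toSpanSingleton k K x ∘ₗ Coalgebra.counit)
        (LinearMap.toSpanSingleton k K y)
        (TensorProduct.map (LinearMap.id) Coalgebra.counit
        (TensorProduct.map A.toSubalgebra.val.toLinearMap A.toSubalgebra.val.toLinearMap t))) := by
    intro t
    induction t with
    | zero => simp
    | add a b ha hb => simp only [map_add, ha, hb]
    | tmul a b =>
      simp [hx a a.2, hy b b.2]
  have hc : TensorProduct.map (LinearMap.id : S.H →ₗ[k] S.H) Coalgebra.counit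
      (Coalgebra.comul (R := k) h) = h ⊗ₜ[k] (1 : k) := Coalgebra.lTensor_counit_comul h
  rw [S.act_mul, ← ht, key, ht, hc]
  simp

/-- The fixed field `K^A = {x | μ(h) x = ε(h) x for all h ∈ A}` of a sub-Hopf algebra `A`. -/
def HopfGaloisStructure.fixedField [FiniteDimensional k K] (S : HopfGaloisStructure k K)
    (A : SubHopfAlgebra k S.H) : IntermediateField k K :=
  Subalgebra.toIntermediateField
    { carrier := {x : K | ∀ h ∈ A.toSubalgebra, S.μ h x = Coalgebra.counit (R := k) h • x}
      mul_mem' := fun hx hy => S.act_mul_of_fixed A hx hy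
      add_mem' := fun hx hy h hh => by rw [map_add, hx h hh, hy h hh, smul_add]
      algebraMap_mem' := fun c h _ => S.act_algebraMap h c }
    (fun x hx => Subalgebra.inv_mem_of_algebraic _ (x := ⟨x, hx⟩)
      (Algebra.IsAlgebraic.isAlgebraic x))

/-- The image of the Galois correspondence `A ↦ K^A` of a Hopf Galois structure. -/
def HopfGaloisStructure.galoisImage [FiniteDimensional k K] (S : HopfGaloisStructure k K) :
    Set (IntermediateField k K) :=
  Set.range S.fixedField

end GaloisCorrespondence

/-! ### Regular subgroups of `Perm G` normalized by `λ(G)` -/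

section Groups

variable (G : Type*) [Group G]

/-- A Hamiltonian group: a non-abelian group all of whose subgroups are normal. -/
def IsHamiltonian : Prop :=
  (∃ a b : G, a * b ≠ b * a) ∧ ∀ H : Subgroup G, H.Normal

/-- `λ : G → Perm G`, `λ_g(x) = g x`. -/
def leftReg : G →* Equiv.Perm G where
  toFun g := Equiv.mulLeft g
  map_one' := by ext; simp
  map_mul' a b := by ext; simp

/-- `ρ : G → Perm G`, `ρ_g(x) = x g⁻¹`. -/
def rightReg : G →* Equiv.Perm G where
  toFun g := Equiv.mulRight g⁻¹
  map_one' := by ext; simp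
  map_mul' a b := by ext; simp

/-- A regular (simply transitive) subgroup of `Perm G` that is normalized by `λ(G)`. -/
structure RegularSubgroup extends Subgroup (Equiv.Perm G) where
  regular : ∀ x y : G, ∃! n : toSubgroup, (n : Equiv.Perm G) x = y
  normalized : ∀ g : G, ∀ n ∈ toSubgroup, leftReg G g * n * (leftReg G g)⁻¹ ∈ toSubgroup

/-- `λ(G)` as a regular subgroup of `Perm G`. -/
def lambdaSubgroup : RegularSubgroup G where
  toSubgroup := (leftReg G).range
  regular x y := by
    refine ⟨⟨leftReg G (y * x⁻¹), _, rfl⟩, by simp [leftReg], ?_⟩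
    rintro ⟨_, g, rfl⟩ h
    have : g * x = y := h
    simp [← this]
  normalized := by
    rintro g _ ⟨a, rfl⟩
    exact ⟨g * a * g⁻¹, by simp⟩

/-- `ρ(G)` as a regular subgroup of `Perm G`. -/
def rhoSubgroup : RegularSubgroup G where
  toSubgroup := (rightReg G).range
  regular x y := by
    refine ⟨⟨rightReg G (y⁻¹ * x), _, rfl⟩, by simp [rightReg], ?_⟩
    rintro ⟨_, g, rfl⟩ h
    have : x * g⁻¹ = y := h
    simp [← this]
  normalized := by
    rintro g _ ⟨a, rfl⟩
    refine ⟨a, ?_⟩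
    rw [eq_mul_inv_iff_mul_eq]
    ext x
    simp [leftReg, rightReg, mul_assoc]

variable {G}

/-- The action of `G` on `N` by conjugation via `λ`: `n ↦ λ_g n λ_g⁻¹`. -/
def RegularSubgroup.conj (N : RegularSubgroup G) (g : G) : N.toSubgroup →* N.toSubgroup where
  toFun n := ⟨leftReg G g * n * (leftReg G g)⁻¹, N.normalized g n n.2⟩
  map_one' := by ext; simp
  map_mul' a b := by ext; simp

/-- `G`-isomorphism of regular subgroups: a group isomorphism commuting with the conjugation
actions of `G` via `λ`. -/
def RegularSubgroup.GIsomorphic (N M : RegularSubgroup G) : Prop :=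
  ∃ φ : N.toSubgroup ≃* M.toSubgroup, ∀ (g : G) (n : N.toSubgroup),
    φ (N.conj g n) = M.conj g (φ n)

end Groups

/-! ### The Hopf Galois structure of a regular subgroup (for `K/k` Galois) -/

section GreitherPareigis

variable {k K : Type*} [Field k] [Field K] [Algebra k K]

/-- The action of `g ∈ Gal(K/k)` on the group algebra `K[N]`, through field automorphisms on `K`
and conjugation on `N`: `∑ aₙ n ↦ ∑ g(aₙ) λ_g n λ_g⁻¹`. -/
noncomputable def RegularSubgroup.galAct (N : RegularSubgroup (K ≃ₐ[k] K)) (g : K ≃ₐ[k] K) :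
    MonoidAlgebra K N.toSubgroup →ₐ[k] MonoidAlgebra K N.toSubgroup :=
  (MonoidAlgebra.mapDomainAlgHom k K (N.conj g)).comp
    (MonoidAlgebra.mapAlgHom N.toSubgroup (g : K →ₐ[k] K))

/-- The `k`-algebra `K[N]^G` of fixed points of `G = Gal(K/k)` in `K[N]`. -/
noncomputable def RegularSubgroup.fixedAlgebra (N : RegularSubgroup (K ≃ₐ[k] K)) :
    Subalgebra k (MonoidAlgebra K N.toSubgroup) :=
  ⨅ g : K ≃ₐ[k] K, AlgHom.equalizer (N.galAct g) (AlgHom.id k _)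

/-- `S` is (a copy of) the Hopf Galois structure given by `N`: its Hopf algebra is `K[N]^G`, with
the comultiplication, counit and antipode restricted from the `K`-Hopf algebra `K[N]`, and the
action is `(∑ aₙ n) · x = ∑ aₙ (n⁻¹(1_G))(x)`.  (The comultiplications are compared in
`K[N] ⊗_K K[N]`, into which `K[N]^G ⊗_k K[N]^G` embeds.) -/
def HopfGaloisStructure.IsGivenBy (S : HopfGaloisStructure k K)
    (N : RegularSubgroup (K ≃ₐ[k] K)) : Prop :=
  ∃ e : S.H ≃ₐ[k] N.fixedAlgebra,
    (∀ h : S.H, Coalgebra.comul (R := K) (e h : MonoidAlgebra K N.toSubgroup) =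
      TensorProduct.mapOfCompatibleSMul K k k (MonoidAlgebra K N.toSubgroup)
        (MonoidAlgebra K N.toSubgroup)
        (TensorProduct.map (N.fixedAlgebra.val.toLinearMap ∘ₗ e.toLinearMap)
          (N.fixedAlgebra.val.toLinearMap ∘ₗ e.toLinearMap) (Coalgebra.comul (R := k) h))) ∧
    (∀ h : S.H, Coalgebra.counit (R := K) (e h : MonoidAlgebra K N.toSubgroup) =
      algebraMap k K (Coalgebra.counit (R := k) h)) ∧
    (∀ h : S.H, HopfAlgebra.antipode K (e h : MonoidAlgebra K N.toSubgroup) =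
      (e (HopfAlgebra.antipode k h) : MonoidAlgebra K N.toSubgroup)) ∧
    (∀ (h : S.H) (x : K), S.μ h x =
      (e h : MonoidAlgebra K N.toSubgroup).coeff.sum
        fun n a => a * ((n : Equiv.Perm (K ≃ₐ[k] K))⁻¹ 1) x)

end GreitherPareigis

end HopfGalois

open HopfGalois

/-! The argument has two ingredients: Galois descent, and the comparison of the conjugation actions
of $G$ on $\rho(G)$ and $\lambda(G)$.

Descent: a $k$-basis of $K[N]^G$ is a $K$-basis of $K[N]$ (`descentBasis`). It spans by Dedekind's
independence of automorphisms and is independent because the trace form is nondegenerate. The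
structure maps of $K[N]$ commute with $G$, so they restrict, and the Hopf axioms are checked in
tensor powers over $K$. The action is a Hopf–Galois action because $K[N] \to \mathrm{End}_k(K)$ is
bijective, by Dedekind and a dimension count (`action_bijective`).

Comparison: $\rho(G)$ commutes with $\lambda(G)$, so $G$ acts trivially on it and the descended
algebra is $k[G]$. On $\lambda(G)$ the action is by inner automorphisms. The group-like elements of
$K[N]^G$ are the fixed points of $G$ in $N$: all of $\rho(G)$, but only the centre of $\lambda(G)$.
As $G$ is not abelian, the Hopf algebras differ.

Galois correspondence: a $G$-stable subgroup $N'$ of $N$ gives the sub-Hopf algebra $K[N']^G$, whose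
fixed field is that of the automorphisms $n^{-1}(1)$, $n \in N'$ (`mem_fixedField_subHopfAlgebra`).
In $\lambda(G)$ the stable subgroups correspond to the normal subgroups of $G$, hence here to all
subgroups, and classical Galois theory yields every intermediate field. -/

namespace HopfGalois

/-! ### Tensor products of linear maps into spaces over a larger field -/

section Tensor

variable {k K A B V W : Type*} [Field k] [Field K] [Algebra k K]
  [AddCommMonoid A] [Module k A] [AddCommMonoid B] [Module k B]
  [AddCommMonoid V] [Module k V] [Module K V] [IsScalarTower k K V]
  [AddCommMonoid W] [Module k W] [Module K W] [IsScalarTower k K W]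

variable (K) in
/-- The map `A ⊗ₖ B → V ⊗_K W` induced by `k`-linear maps `A → V` and `B → W`. -/
noncomputable def tensorMap (f : A →ₗ[k] V) (g : B →ₗ[k] W) : A ⊗[k] B →ₗ[k] V ⊗[K] W :=
  TensorProduct.mapOfCompatibleSMul K k k V W ∘ₗ TensorProduct.map f g

@[simp]
theorem tensorMap_tmul (f : A →ₗ[k] V) (g : B →ₗ[k] W) (a : A) (b : B) :
    tensorMap K f g (a ⊗ₜ b) = f a ⊗ₜ[K] g b := rfl

theorem injective_of_linearIndependent_comp_basis {ι : Type*} (f : A →ₗ[k] V)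
    (b : Module.Basis ι k A) (h : LinearIndependent K (f ∘ b)) : Function.Injective f := by
  have h' : LinearIndependent k (f ∘ b) := h.restrict_scalars' k
  have hf : f = b.constr k (f ∘ b) := (b.constr_eq k fun _ => rfl).symm
  rw [hf]
  exact b.injective_constr_of_linearIndependent h'

/-- Mere injectivity of `f` and `g` over $k$ would not pass to $A \otimes_k B \to V \otimes_K W$.
Independence over $K$ does, and can be iterated for triple tensors. -/
theorem linearIndependent_tensorMap {ι κ : Type*} (f : A →ₗ[k] V) (g : B →ₗ[k] W)
    (b : Module.Basis ι k A) (c : Module.Basis κ k B)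
    (hf : LinearIndependent K (f ∘ b)) (hg : LinearIndependent K (g ∘ c)) :
    LinearIndependent K (tensorMap K f g ∘ b.tensorProduct c) := by
  have h : tensorMap K f g ∘ b.tensorProduct c =
      fun i : ι × κ => (f ∘ b) i.1 ⊗ₜ[K] (g ∘ c) i.2 := by
    ext ⟨i, j⟩
    simp
  rw [h]
  let : AddCommGroup V := Module.addCommMonoidToAddCommGroup K
  let : AddCommGroup W := Module.addCommMonoidToAddCommGroup K
  exact LinearIndependent.tmul_of_isDomain hf hg

theorem tensorMap_map {A' B' V' W' : Type*} [AddCommMonoid A'] [Module k A']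
    [AddCommMonoid B'] [Module k B'] [AddCommMonoid V'] [Module k V'] [Module K V']
    [IsScalarTower k K V'] [AddCommMonoid W'] [Module k W'] [Module K W'] [IsScalarTower k K W']
    {f : A →ₗ[k] V} {g : B →ₗ[k] W} {f' : A' →ₗ[k] V'} {g' : B' →ₗ[k] W'}
    {φ : A →ₗ[k] A'} {ψ : B →ₗ[k] B'} {Φ : V →ₗ[K] V'} {Ψ : W →ₗ[K] W'}
    (h₁ : ∀ a, f' (φ a) = Φ (f a)) (h₂ : ∀ b, g' (ψ b) = Ψ (g b)) (t : A ⊗[k] B) :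
    tensorMap K f' g' (TensorProduct.map φ ψ t) =
      TensorProduct.map Φ Ψ (tensorMap K f g t) := by
  induction t with
  | zero => simp
  | add x y hx hy => simp only [map_add, hx, hy]
  | tmul a b => simp [h₁, h₂]

theorem tensorMap_assoc {C X : Type*} [AddCommMonoid C] [Module k C]
    [AddCommMonoid X] [Module k X] [Module K X] [IsScalarTower k K X]
    (f : A →ₗ[k] V) (g : B →ₗ[k] W) (h : C →ₗ[k] X) (t : (A ⊗[k] B) ⊗[k] C) :
    tensorMap K f (tensorMap K g h) (TensorProduct.assoc k A B C t) =
      TensorProduct.assoc K V W X (tensorMap K (tensorMap K f g) h t) := by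
  induction t with
  | zero => simp
  | add x y hx hy => simp only [map_add, hx, hy]
  | tmul s c =>
    induction s with
    | zero => simp
    | add x y hx hy => simp only [map_add, TensorProduct.add_tmul, hx, hy]
    | tmul a b => simp

theorem tensorMap_comm (f : A →ₗ[k] V) (g : B →ₗ[k] W) (t : A ⊗[k] B) :
    tensorMap K g f (TensorProduct.comm k A B t) =
      TensorProduct.comm K V W (tensorMap K f g t) := by
  induction t with
  | zero => simp
  | add x y hx hy => simp only [map_add, hx, hy]
  | tmul a b => simp

/-- A coalgebra structure over `K` descends to a `k`-module `A` along a map `f : A → V` sending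
`k`-bases to `K`-linearly independent families, once comultiplication and counit restrict. -/
abbrev coalgebraOfTensorMap [Coalgebra K V] {ι : Type*} (f : A →ₗ[k] V)
    (b : Module.Basis ι k A) (hf : LinearIndependent K (f ∘ b))
    (δ : A →ₗ[k] A ⊗[k] A) (ε : A →ₗ[k] k)
    (hδ : ∀ a, tensorMap K f f (δ a) = Coalgebra.comul (f a))
    (hε : ∀ a, algebraMap k K (ε a) = Coalgebra.counit (f a)) : Coalgebra k A where
  comul := δ
  counit := ε
  coassoc := by
    ext a : 1
    -- The triple tensor power of $A$ embeds in that of $V$ over $K$, where coassociativity is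
    -- known.
    apply injective_of_linearIndependent_comp_basis (tensorMap K f (tensorMap K f f)) _
      (linearIndependent_tensorMap _ _ b _ hf (linearIndependent_tensorMap f f b b hf hf))
    refine (tensorMap_assoc f f f _).trans ?_
    refine Eq.trans ?_ (tensorMap_map (f := f) (g := f) (φ := .id) (ψ := δ)
      (Φ := .id) (Ψ := Coalgebra.comul (R := K)) (fun _ => rfl) hδ _).symm
    refine (congrArg _ (tensorMap_map (f := f) (g := f) (φ := δ) (ψ := .id)
      (Φ := Coalgebra.comul (R := K)) (Ψ := .id) hδ (fun _ => rfl) _)).trans ?_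
    rw [hδ]
    exact Coalgebra.coassoc_apply (f a)
  rTensor_counit_comp_comul := by
    ext a : 1
    apply (TensorProduct.lid k A).injective
    apply injective_of_linearIndependent_comp_basis f b hf
    have : ∀ t, f (TensorProduct.lid k A (ε.rTensor A t)) =
        TensorProduct.lid K V (Coalgebra.counit.rTensor V (tensorMap K f f t)) := by
      intro t
      induction t with
      | zero => simp
      | add x y hx hy => simp only [map_add, hx, hy]
      | tmul x y => simp [← hε]
    refine (this _).trans ?_
    simp [hδ]
  lTensor_counit_comp_comul := by
    ext a : 1
    apply (TensorProduct.rid k A).injective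
    apply injective_of_linearIndependent_comp_basis f b hf
    have : ∀ t, f (TensorProduct.rid k A (ε.lTensor A t)) =
        TensorProduct.rid K V (Coalgebra.counit.lTensor V (tensorMap K f f t)) := by
      intro t
      induction t with
      | zero => simp
      | add x y hx hy => simp only [map_add, hx, hy]
      | tmul x y => simp [← hε]
    refine (this _).trans ?_
    simp [hδ]

theorem tensorProduct_repr_comul_single {M ι : Type*} [Monoid M]
    (c : Module.Basis ι K (MonoidAlgebra K M)) (n : M) (a : K) (i j : ι) :
    (c.tensorProduct c).repr (Coalgebra.comul (R := K) (MonoidAlgebra.single n a)) (i, j) =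
      a * (c.repr (MonoidAlgebra.single n 1) i * c.repr (MonoidAlgebra.single n 1) j) := by
  have h : MonoidAlgebra.single n a = a • MonoidAlgebra.single n (1 : K) := by simp
  have h' : Coalgebra.comul (R := K) (MonoidAlgebra.single n (1 : K)) =
      MonoidAlgebra.single n 1 ⊗ₜ[K] MonoidAlgebra.single n 1 := by simp
  rw [h, map_smul, map_smul, h', Finsupp.smul_apply,
    Module.Basis.tensorProduct_repr_tmul_apply, smul_eq_mul, smul_eq_mul]
  ring

end Tensor

/-! ### Galois descent for `K[N]` -/

section Descent

variable {k K : Type*} [Field k] [Field K] [Algebra k K]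
  (N : RegularSubgroup (K ≃ₐ[k] K))

open MonoidAlgebra

namespace RegularSubgroup

@[simp]
theorem galAct_single (g : K ≃ₐ[k] K) (n : N.toSubgroup) (a : K) :
    N.galAct g (single n a) = single (N.conj g n) (g a) := by
  simp [galAct]

theorem mem_fixedAlgebra {v : MonoidAlgebra K N.toSubgroup} :
    v ∈ N.fixedAlgebra ↔ ∀ g, N.galAct g v = v := by
  simp [fixedAlgebra, Algebra.mem_iInf]

theorem galAct_coe (g : K ≃ₐ[k] K) (h : N.fixedAlgebra) :
    N.galAct g (h : MonoidAlgebra K N.toSubgroup) = h :=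
  N.mem_fixedAlgebra.1 h.2 g

theorem galAct_smul (g : K ≃ₐ[k] K) (c : K) (v : MonoidAlgebra K N.toSubgroup) :
    N.galAct g (c • v) = g c • N.galAct g v := by
  induction v using MonoidAlgebra.induction_linear with
  | zero => simp
  | add x y hx hy => simp only [smul_add, map_add, hx, hy]
  | single n a => simp

theorem conj_mul (g h : K ≃ₐ[k] K) (n : N.toSubgroup) :
    N.conj (g * h) n = N.conj g (N.conj h n) := by
  ext; simp [conj, mul_assoc]

theorem conj_one (n : N.toSubgroup) : N.conj 1 n = n := by
  ext; simp [conj]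

theorem galAct_mul (g h : K ≃ₐ[k] K) (v : MonoidAlgebra K N.toSubgroup) :
    N.galAct (g * h) v = N.galAct g (N.galAct h v) := by
  induction v using MonoidAlgebra.induction_linear with
  | zero => simp
  | add x y hx hy => simp only [map_add, hx, hy]
  | single n a => simp [conj_mul]

variable [FiniteDimensional k K]

theorem sum_galAct_mem (v : MonoidAlgebra K N.toSubgroup) :
    ∑ g, N.galAct g v ∈ N.fixedAlgebra := by
  rw [mem_fixedAlgebra]
  intro h
  simp only [map_sum, ← galAct_mul]
  exact Fintype.sum_equiv (Equiv.mulLeft h) _ _ fun _ => rfl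

/-- A functional `f` killing the fixed points kills every trace $\sum_g g(c)\,{}^g n$. Letting $c$
vary gives a linear relation between the automorphisms $g$ with coefficients $f({}^g n)$. Dedekind
makes these vanish, and $g = 1$ gives $f(n) = 0$. -/
theorem span_fixedAlgebra :
    Submodule.span K (N.fixedAlgebra : Set (MonoidAlgebra K N.toSubgroup)) = ⊤ := by
  by_contra hne
  obtain ⟨f, hf0, hf⟩ := Submodule.exists_le_ker_of_lt_top _ (lt_top_iff_ne_top.2 hne)
  apply hf0
  ext n
  have key : ∑ g : K ≃ₐ[k] K, f (single (N.conj g n) 1) • (g : K →ₐ[k] K).toLinearMap = 0 := by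
    ext c
    have := hf (Submodule.subset_span (N.sum_galAct_mem (single n c)))
    simp only [galAct_single, LinearMap.mem_ker, map_sum] at this
    simp only [LinearMap.sum_apply, LinearMap.smul_apply, LinearMap.zero_apply]
    rw [← this]
    refine Finset.sum_congr rfl fun g _ => ?_
    rw [← mul_one (g c), ← smul_eq_mul, ← MonoidAlgebra.smul_single, map_smul]
    simp [mul_comm]
  have hli : LinearIndependent K fun g : K ≃ₐ[k] K => (g : K →ₐ[k] K).toLinearMap :=
    (linearIndependent_toLinearMap k K K).comp (fun g : K ≃ₐ[k] K => (g : K →ₐ[k] K))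
      (fun g h hgh => AlgEquiv.ext fun x => DFunLike.congr_fun hgh x)
  have := Fintype.linearIndependent_iff.1 hli _ key 1
  simpa [conj_one] using this

variable [IsGalois k K]

/-- Multiplying a relation $\sum c_i v_i = 0$ by $d$ and summing over $G$ gives $\sum
\mathrm{Tr}(c_i d) v_i = 0$, a relation over $k$. So $\mathrm{Tr}(c_i d) = 0$ for all $d$, and the
trace form is nondegenerate. -/
theorem linearIndependent_of_mem_fixedAlgebra {ι : Type*}
    {v : ι → MonoidAlgebra K N.toSubgroup} (hv : ∀ i, v i ∈ N.fixedAlgebra)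
    (hli : LinearIndependent k v) : LinearIndependent K v := by
  classical
  rw [linearIndependent_iff'] at hli ⊢
  intro s c hc i hi
  apply (traceForm_nondegenerate k K).1
  intro d
  refine hli s (fun i => Algebra.trace k K (c i * d)) ?_ i hi
  calc ∑ i ∈ s, Algebra.trace k K (c i * d) • v i
      = ∑ i ∈ s, (algebraMap k K (Algebra.trace k K (c i * d))) • v i := by
        simp only [algebraMap_smul]
    _ = ∑ i ∈ s, (∑ g : K ≃ₐ[k] K, g (c i * d)) • v i := by
        simp only [trace_eq_sum_automorphisms]
    _ = ∑ g : K ≃ₐ[k] K, N.galAct g (d • ∑ i ∈ s, c i • v i) := by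
        simp only [Finset.sum_smul, Finset.smul_sum, map_sum, galAct_smul]
        rw [Finset.sum_comm]
        refine Finset.sum_congr rfl fun g _ => Finset.sum_congr rfl fun i _ => ?_
        rw [N.mem_fixedAlgebra.1 (hv i) g, map_mul, mul_comm, mul_smul]
    _ = 0 := by simp [hc]

/-- A `k`-basis of `K[N]^G` is a `K`-basis of `K[N]`. -/
noncomputable def descentBasis {ι : Type*} (b : Module.Basis ι k N.fixedAlgebra) :
    Module.Basis ι K (MonoidAlgebra K N.toSubgroup) :=
  Module.Basis.mk (v := fun i => (b i : MonoidAlgebra K N.toSubgroup))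
    (N.linearIndependent_of_mem_fixedAlgebra (fun i => (b i).2)
      (b.linearIndependent.map' N.fixedAlgebra.val.toLinearMap
        (LinearMap.ker_eq_bot.2 Subtype.val_injective)))
    (by
      rw [← N.span_fixedAlgebra, Submodule.span_le]
      intro v hv
      have h1 : (⟨v, hv⟩ : N.fixedAlgebra) ∈ Submodule.span k (Set.range b) := by
        rw [b.span_eq]; trivial
      have h2 := Submodule.mem_map_of_mem (f := N.fixedAlgebra.val.toLinearMap) h1
      rw [Submodule.map_span, ← Set.range_comp] at h2
      exact Submodule.span_le_restrictScalars k K _ h2)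

@[simp]
theorem descentBasis_apply {ι : Type*} (b : Module.Basis ι k N.fixedAlgebra) (i : ι) :
    N.descentBasis b i = (b i : MonoidAlgebra K N.toSubgroup) := by
  simp [descentBasis]

/-- The basis vectors are fixed by $G$, so $G$ moves only the coordinates. -/
theorem descentBasis_repr_galAct {ι : Type*} (b : Module.Basis ι k N.fixedAlgebra)
    (g : K ≃ₐ[k] K) (v : MonoidAlgebra K N.toSubgroup) (i : ι) :
    (N.descentBasis b).repr (N.galAct g v) i = g ((N.descentBasis b).repr v i) := by
  classical
  obtain ⟨c, rfl⟩ := (N.descentBasis b).repr.symm.surjective v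
  induction c using Finsupp.induction_linear with
  | zero => simp
  | add x y hx hy => simp only [map_add, Finsupp.add_apply, hx, hy]
  | single j a =>
    rw [Module.Basis.repr_symm_single, galAct_smul, descentBasis_apply, galAct_coe,
      ← descentBasis_apply, map_smul, map_smul, Module.Basis.repr_self]
    by_cases hij : j = i <;> simp [hij]

theorem finrank_fixedAlgebra : Module.finrank k N.fixedAlgebra = Nat.card N.toSubgroup := by
  have b := Module.Free.chooseBasis k N.fixedAlgebra
  have := Fintype.ofFinite N.toSubgroup
  rw [Module.finrank_eq_nat_card_basis b, ← Module.finrank_eq_nat_card_basis (N.descentBasis b),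
    Module.finrank_eq_nat_card_basis (MonoidAlgebra.basis N.toSubgroup K)]

end RegularSubgroup

end Descent

/-! ### The Hopf algebra `K[N]^G` -/

section HopfAlgebra

variable {k K : Type*} [Field k] [Field K] [Algebra k K]
  (N : RegularSubgroup (K ≃ₐ[k] K))

open MonoidAlgebra Coalgebra

namespace RegularSubgroup

theorem counit_galAct (g : K ≃ₐ[k] K) (v : MonoidAlgebra K N.toSubgroup) :
    counit (R := K) (N.galAct g v) = g (counit (R := K) v) := by
  induction v using MonoidAlgebra.induction_linear with
  | zero => simp
  | add x y hx hy => simp only [map_add, hx, hy]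
  | single n a => simp

theorem antipode_galAct (g : K ≃ₐ[k] K) (v : MonoidAlgebra K N.toSubgroup) :
    HopfAlgebra.antipode K (N.galAct g v) = N.galAct g (HopfAlgebra.antipode K v) := by
  induction v using MonoidAlgebra.induction_linear with
  | zero => simp
  | add x y hx hy => simp only [map_add, hx, hy]
  | single n a => simp

variable [FiniteDimensional k K]

instance finite_fixedAlgebra : Module.Finite k N.fixedAlgebra := by
  have : Module.Finite K (MonoidAlgebra K N.toSubgroup) :=
    Module.Finite.of_basis (MonoidAlgebra.basis N.toSubgroup K)
  have : Module.Finite k (MonoidAlgebra K N.toSubgroup) := Module.Finite.trans K _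
  exact Module.Finite.of_injective N.fixedAlgebra.val.toLinearMap Subtype.val_injective

variable [IsGalois k K]

/-- The embedding `K[N]^G ⊗ₖ K[N]^G → K[N] ⊗_K K[N]`. -/
noncomputable def tensorVal : N.fixedAlgebra ⊗[k] N.fixedAlgebra →ₐ[k]
    MonoidAlgebra K N.toSubgroup ⊗[K] MonoidAlgebra K N.toSubgroup :=
  (Algebra.TensorProduct.mapOfCompatibleSMul K k k _ _).comp
    (Algebra.TensorProduct.map N.fixedAlgebra.val N.fixedAlgebra.val)

omit [FiniteDimensional k K] [IsGalois k K] in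
@[simp]
theorem tensorVal_tmul (a b : N.fixedAlgebra) : N.tensorVal (a ⊗ₜ b) =
    (a : MonoidAlgebra K N.toSubgroup) ⊗ₜ[K] (b : MonoidAlgebra K N.toSubgroup) := rfl

omit [FiniteDimensional k K] [IsGalois k K] in
theorem tensorVal_toLinearMap : N.tensorVal.toLinearMap =
    tensorMap K N.fixedAlgebra.val.toLinearMap N.fixedAlgebra.val.toLinearMap := by
  ext; simp

theorem linearIndependent_val_comp_basis {ι : Type*} (b : Module.Basis ι k N.fixedAlgebra) :
    LinearIndependent K (N.fixedAlgebra.val.toLinearMap ∘ b) := by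
  convert (N.descentBasis b).linearIndependent using 1
  ext i : 1
  simp

theorem linearIndependent_tensorVal {ι : Type*} (b : Module.Basis ι k N.fixedAlgebra) :
    LinearIndependent K (N.tensorVal.toLinearMap ∘ b.tensorProduct b) := by
  rw [tensorVal_toLinearMap]
  exact linearIndependent_tensorMap _ _ b b (N.linearIndependent_val_comp_basis b)
    (N.linearIndependent_val_comp_basis b)

theorem tensorVal_injective : Function.Injective N.tensorVal :=
  injective_of_linearIndependent_comp_basis N.tensorVal.toLinearMap _
    (N.linearIndependent_tensorVal (Module.Free.chooseBasis k N.fixedAlgebra))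

theorem comul_mem_range_tensorVal (h : N.fixedAlgebra) :
    comul (R := K) (h : MonoidAlgebra K N.toSubgroup) ∈ N.tensorVal.range := by
  let b := Module.Free.chooseBasis k N.fixedAlgebra
  let B := (N.descentBasis b).tensorProduct (N.descentBasis b)
  -- Coordinates of $\Delta(v)$ in the product basis are Galois-equivariant in $v$; for fixed $v$
  -- they therefore lie in $k$.
  have key : ∀ (p) (g : K ≃ₐ[k] K) (v : MonoidAlgebra K N.toSubgroup),
      B.repr (comul (R := K) (N.galAct g v)) p =
        g (B.repr (comul (R := K) v) p) := by
    rintro ⟨i, j⟩ g v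
    induction v using MonoidAlgebra.induction_linear with
    | zero => simp
    | add x y hx hy => simp only [map_add, Finsupp.add_apply, hx, hy]
    | single n a =>
      have h1 : ∀ (n : N.toSubgroup) (i), (N.descentBasis b).repr (single (N.conj g n) 1) i =
          g ((N.descentBasis b).repr (single n 1) i) := by
        intro n i
        rw [← descentBasis_repr_galAct]
        simp
      rw [galAct_single, tensorProduct_repr_comul_single, tensorProduct_repr_comul_single, h1, h1,
        map_mul, map_mul]
  rw [← B.sum_repr (comul (R := K) (h : MonoidAlgebra K N.toSubgroup))]
  refine sum_mem fun p _ => ?_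
  obtain ⟨c, hc⟩ := (IsGalois.mem_range_algebraMap_iff_fixed (F := k)
    (B.repr (comul (R := K) (h : MonoidAlgebra K N.toSubgroup)) p)).2
    fun g => by rw [← key, galAct_coe]
  rw [← hc, algebraMap_smul]
  refine Subalgebra.smul_mem N.tensorVal.range ?_ c
  rw [Module.Basis.tensorProduct_apply', descentBasis_apply, descentBasis_apply]
  exact ⟨b p.1 ⊗ₜ b p.2, N.tensorVal_tmul _ _⟩

theorem counit_mem_range (h : N.fixedAlgebra) :
    counit (R := K) (h : MonoidAlgebra K N.toSubgroup) ∈ (Algebra.ofId k K).range :=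
  (IsGalois.mem_range_algebraMap_iff_fixed (F := k) _).2
    fun g => by rw [← counit_galAct, galAct_coe]

/-- The comultiplication of `K[N]^G`. -/
noncomputable def comulHom : N.fixedAlgebra →ₐ[k] N.fixedAlgebra ⊗[k] N.fixedAlgebra :=
  (AlgEquiv.ofInjective N.tensorVal N.tensorVal_injective).symm.toAlgHom.comp
    ((((Bialgebra.comulAlgHom K (MonoidAlgebra K N.toSubgroup)).restrictScalars k).comp
      N.fixedAlgebra.val).codRestrict _ N.comul_mem_range_tensorVal)

/-- The counit of `K[N]^G`. -/
noncomputable def counitHom : N.fixedAlgebra →ₐ[k] k :=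
  (AlgEquiv.ofInjective (Algebra.ofId k K) (algebraMap k K).injective).symm.toAlgHom.comp
    ((((Bialgebra.counitAlgHom K (MonoidAlgebra K N.toSubgroup)).restrictScalars k).comp
      N.fixedAlgebra.val).codRestrict _ N.counit_mem_range)

/-- The antipode of `K[N]^G`. -/
noncomputable def antipodeMap : N.fixedAlgebra →ₗ[k] N.fixedAlgebra :=
  (((HopfAlgebra.antipode K).restrictScalars k).comp N.fixedAlgebra.val.toLinearMap).codRestrict
    (Subalgebra.toSubmodule N.fixedAlgebra) fun h => N.mem_fixedAlgebra.2 fun g => by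
      simp [← antipode_galAct, galAct_coe]

@[simp]
theorem tensorVal_comulHom (h : N.fixedAlgebra) : N.tensorVal (N.comulHom h) =
    comul (R := K) (h : MonoidAlgebra K N.toSubgroup) :=
  congrArg Subtype.val ((AlgEquiv.ofInjective N.tensorVal N.tensorVal_injective).apply_symm_apply _)

@[simp]
theorem algebraMap_counitHom (h : N.fixedAlgebra) : algebraMap k K (N.counitHom h) =
    counit (R := K) (h : MonoidAlgebra K N.toSubgroup) :=
  congrArg Subtype.val ((AlgEquiv.ofInjective (Algebra.ofId k K)
    (algebraMap k K).injective).apply_symm_apply _)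

-- Reduces the convolution identities for the antipode to those of $K[N]$.
omit [FiniteDimensional k K] [IsGalois k K] in
theorem coe_mul'_map (f g : N.fixedAlgebra →ₗ[k] N.fixedAlgebra)
    (F G : MonoidAlgebra K N.toSubgroup →ₗ[K] MonoidAlgebra K N.toSubgroup)
    (hf : ∀ h, (f h : MonoidAlgebra K N.toSubgroup) = F h)
    (hg : ∀ h, (g h : MonoidAlgebra K N.toSubgroup) = G h)
    (t : N.fixedAlgebra ⊗[k] N.fixedAlgebra) :
    (LinearMap.mul' k N.fixedAlgebra (TensorProduct.map f g t) : MonoidAlgebra K N.toSubgroup) =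
      LinearMap.mul' K _ (TensorProduct.map F G (N.tensorVal t)) := by
  induction t with
  | zero => simp
  | add x y hx hy => simp only [map_add, ← hx, ← hy]; rfl
  | tmul a b => simp [hf, hg]

noncomputable instance bialgebra : Bialgebra k N.fixedAlgebra :=
  letI : Coalgebra k N.fixedAlgebra :=
    coalgebraOfTensorMap N.fixedAlgebra.val.toLinearMap (Module.Free.chooseBasis k N.fixedAlgebra)
      (N.linearIndependent_val_comp_basis _) N.comulHom.toLinearMap N.counitHom.toLinearMap
      (fun h => (DFunLike.congr_fun N.tensorVal_toLinearMap _).symm.trans (N.tensorVal_comulHom h))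
      N.algebraMap_counitHom
  Bialgebra.mk' k N.fixedAlgebra (map_one N.counitHom) (map_mul N.counitHom _ _)
    (map_one N.comulHom) (map_mul N.comulHom _ _)

noncomputable instance hopfAlgebra : HopfAlgebra k N.fixedAlgebra where
  antipode := N.antipodeMap
  mul_antipode_rTensor_comul := by
    ext h : 1
    apply Subtype.val_injective
    refine (N.coe_mul'_map N.antipodeMap LinearMap.id (HopfAlgebra.antipode K) LinearMap.id
      (fun _ => rfl) (fun _ => rfl) (N.comulHom h)).trans ?_
    rw [tensorVal_comulHom]
    refine (HopfAlgebra.mul_antipode_rTensor_comul_apply _).trans ?_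
    rw [← algebraMap_counitHom, ← IsScalarTower.algebraMap_apply]
    rfl
  mul_antipode_lTensor_comul := by
    ext h : 1
    apply Subtype.val_injective
    refine (N.coe_mul'_map LinearMap.id N.antipodeMap LinearMap.id (HopfAlgebra.antipode K)
      (fun _ => rfl) (fun _ => rfl) (N.comulHom h)).trans ?_
    rw [tensorVal_comulHom]
    refine (HopfAlgebra.mul_antipode_lTensor_comul_apply _).trans ?_
    rw [← algebraMap_counitHom, ← IsScalarTower.algebraMap_apply]
    rfl

instance isCocomm : IsCocomm k N.fixedAlgebra where
  comm_comp_comul := by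
    ext h : 1
    apply N.tensorVal_injective
    have : ∀ t, N.tensorVal (TensorProduct.comm k _ _ t) =
        TensorProduct.comm K _ _ (N.tensorVal t) := fun t => by
      have h := DFunLike.congr_fun N.tensorVal_toLinearMap
      exact (h _).trans ((tensorMap_comm _ _ t).trans (congrArg _ (h t).symm))
    refine (this _).trans ?_
    change TensorProduct.comm K _ _ (N.tensorVal (N.comulHom h)) = N.tensorVal (N.comulHom h)
    rw [tensorVal_comulHom, Coalgebra.comm_comul]

end RegularSubgroup

end HopfAlgebra

/-! ### The action of `K[N]^G` on `K` -/

section Action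

variable {k K : Type*} [Field k] [Field K] [Algebra k K]
  (N : RegularSubgroup (K ≃ₐ[k] K))

open MonoidAlgebra Coalgebra

namespace RegularSubgroup

/-- The map `K[N] → End_k(K)` sending `∑ aₙ n` to `x ↦ ∑ aₙ (n⁻¹(1))(x)`. -/
noncomputable def action : MonoidAlgebra K N.toSubgroup →ₗ[K] Module.End k K :=
  Finsupp.linearCombination K (fun n : N.toSubgroup =>
    (((n : Equiv.Perm (K ≃ₐ[k] K))⁻¹ 1 : K ≃ₐ[k] K) : K →ₐ[k] K).toLinearMap) ∘ₗ
    (coeffLinearEquiv K).toLinearMap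

theorem action_apply (v : MonoidAlgebra K N.toSubgroup) (x : K) :
    N.action v x = v.coeff.sum fun n a => a * ((n : Equiv.Perm (K ≃ₐ[k] K))⁻¹ 1) x := by
  simp [action, Finsupp.linearCombination_apply, Finsupp.sum, LinearMap.sum_apply]

@[simp]
theorem action_single (n : N.toSubgroup) (a x : K) :
    N.action (single n a) x = a * ((n : Equiv.Perm (K ≃ₐ[k] K))⁻¹ 1) x := by
  simp [action_apply]

/-- Evaluation of the action at `x`. -/
noncomputable def actionAt (x : K) : MonoidAlgebra K N.toSubgroup →ₗ[K] K where
  toFun v := N.action v x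
  map_add' _ _ := by simp
  map_smul' _ _ := by simp

@[simp]
theorem actionAt_apply (x : K) (v : MonoidAlgebra K N.toSubgroup) :
    N.actionAt x v = N.action v x := rfl

theorem inv_conj_apply (g : K ≃ₐ[k] K) (m : N.toSubgroup) :
    ((N.conj g m : N.toSubgroup) : Equiv.Perm (K ≃ₐ[k] K))⁻¹ g =
      g * (m : Equiv.Perm (K ≃ₐ[k] K))⁻¹ 1 := by
  simp [conj, leftReg, mul_inv_rev]

/-- The action of $K[N]$ is multiplicative only up to a twist: with $g = n^{-1}(1)$, the product of
$n$ and ${}^g m$ acts through $({}^g m)^{-1}(g) = g \circ m^{-1}(1)$. The twist disappears when $v$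
is fixed by $G$. -/
theorem action_single_mul (n : N.toSubgroup) (a : K) (v : MonoidAlgebra K N.toSubgroup) (x : K) :
    N.action (single n a * N.galAct ((n : Equiv.Perm (K ≃ₐ[k] K))⁻¹ 1) v) x =
      N.action (single n a) (N.action v x) := by
  induction v using MonoidAlgebra.induction_linear with
  | zero => simp
  | add y z hy hz => simp only [mul_add, map_add, LinearMap.add_apply, hy, hz]
  | single m b =>
    rw [galAct_single, single_mul_single, action_single, action_single, action_single, map_mul,
      Subgroup.coe_mul, mul_inv_rev, Equiv.Perm.mul_apply, inv_conj_apply]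
    simp [mul_assoc]

theorem action_mul (a : MonoidAlgebra K N.toSubgroup) {b : MonoidAlgebra K N.toSubgroup}
    (hb : b ∈ N.fixedAlgebra) (x : K) : N.action (a * b) x = N.action a (N.action b x) := by
  induction a using MonoidAlgebra.induction_linear with
  | zero => simp
  | add y z hy hz => simp only [add_mul, map_add, LinearMap.add_apply, hy, hz]
  | single n a =>
    rw [← action_single_mul, N.mem_fixedAlgebra.1 hb]

theorem inv_apply_one_injective :
    Function.Injective fun n : N.toSubgroup => (n : Equiv.Perm (K ≃ₐ[k] K))⁻¹ 1 := by
  intro n m h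
  exact inv_injective ((N.regular 1 _).unique (y₁ := n⁻¹) (y₂ := m⁻¹) h rfl)

theorem exists_inv_apply_one_eq (g : K ≃ₐ[k] K) :
    ∃ n : N.toSubgroup, (n : Equiv.Perm (K ≃ₐ[k] K))⁻¹ 1 = g := by
  obtain ⟨n, hn, -⟩ := N.regular 1 g
  exact ⟨n⁻¹, by simpa using hn⟩

variable [FiniteDimensional k K]

omit [FiniteDimensional k K] in
theorem action_injective : Function.Injective N.action := by
  have h : LinearIndependent K fun n : N.toSubgroup =>
      (((n : Equiv.Perm (K ≃ₐ[k] K))⁻¹ 1 : K ≃ₐ[k] K) : K →ₐ[k] K).toLinearMap :=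
    (linearIndependent_toLinearMap k K K).comp
      (fun n : N.toSubgroup => (((n : Equiv.Perm (K ≃ₐ[k] K))⁻¹ 1 : K ≃ₐ[k] K) : K →ₐ[k] K))
      (fun n m hnm => N.inv_apply_one_injective
        (AlgEquiv.ext fun x => DFunLike.congr_fun hnm x))
  intro a b hab
  exact (coeffLinearEquiv (S := K) (M := N.toSubgroup) K).injective (h hab)

omit [FiniteDimensional k K] in
theorem card_eq : Nat.card N.toSubgroup = Nat.card (K ≃ₐ[k] K) :=
  Nat.card_congr (Equiv.ofBijective _ ⟨N.inv_apply_one_injective, N.exists_inv_apply_one_eq⟩)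

variable [IsGalois k K]

theorem action_bijective : Function.Bijective N.action := by
  refine ⟨N.action_injective, ?_⟩
  have : Module.Finite K (MonoidAlgebra K N.toSubgroup) :=
    Module.Finite.of_basis (MonoidAlgebra.basis N.toSubgroup K)
  have : Module.Finite k (MonoidAlgebra K N.toSubgroup) := Module.Finite.trans K _
  have h : Module.finrank k (MonoidAlgebra K N.toSubgroup) =
      Module.finrank k (Module.End k K) := by
    rw [← Module.finrank_mul_finrank k K,
      Module.finrank_eq_nat_card_basis (MonoidAlgebra.basis N.toSubgroup K), card_eq,
      IsGalois.card_aut_eq_finrank, Module.finrank_linearMap]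
  exact (LinearMap.injective_iff_surjective_of_finrank_eq_finrank
    (f := N.action.restrictScalars k) h).1 N.action_injective

/-- The action of `K[N]^G` on `K`, as an algebra homomorphism. -/
noncomputable def actionHom : N.fixedAlgebra →ₐ[k] Module.End k K :=
  AlgHom.ofLinearMap (N.action.restrictScalars k ∘ₗ N.fixedAlgebra.val.toLinearMap)
    (by ext x; simp [one_def])
    (fun a b => by ext x; exact N.action_mul a b.2 x)

omit [FiniteDimensional k K] [IsGalois k K] in
@[simp]
theorem actionHom_apply (h : N.fixedAlgebra) :
    N.actionHom h = N.action (h : MonoidAlgebra K N.toSubgroup) := rfl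

omit [FiniteDimensional k K] [IsGalois k K] in
theorem action_one_right (v : MonoidAlgebra K N.toSubgroup) :
    N.action v 1 = counit (R := K) v := by
  induction v using MonoidAlgebra.induction_linear with
  | zero => simp
  | add y z hy hz => simp only [map_add, LinearMap.add_apply, hy, hz]
  | single m b => simp

omit [FiniteDimensional k K] [IsGalois k K] in
theorem action_mul_right (v : MonoidAlgebra K N.toSubgroup) (x y : K) :
    N.action v (x * y) = LinearMap.mul' K K
      (TensorProduct.map (N.actionAt x) (N.actionAt y) (comul (R := K) v)) := by
  induction v using MonoidAlgebra.induction_linear with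
  | zero => simp
  | add y z hy hz => simp only [map_add, LinearMap.add_apply, hy, hz]
  | single m b =>
    simp only [action_single, comul_single, CommSemiring.comul_apply, TensorProduct.map_tmul,
      lsingle_apply, actionAt_apply, LinearMap.mul'_apply, map_mul]
    ring

/-- Descent identifies $K \otimes_k K[N]^G$ with $K[N]$ (the map `L`), and the canonical map becomes
`N.action`. -/
theorem canonicalMap_actionHom_bijective :
    Function.Bijective (canonicalMap N.actionHom.toLinearMap) := by
  let b := Module.Free.chooseBasis k N.fixedAlgebra
  let L := (Algebra.TensorProduct.basis K b).equiv (N.descentBasis b) (.refl _)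
  have hL : ∀ (x : K) (h : N.fixedAlgebra),
      L (x ⊗ₜ h) = x • (h : MonoidAlgebra K N.toSubgroup) := by
    intro x h
    have : L.toLinearMap.restrictScalars k ∘ₗ TensorProduct.mk k K N.fixedAlgebra 1 =
        N.fixedAlgebra.val.toLinearMap := by
      refine b.ext fun i => ?_
      have := (Algebra.TensorProduct.basis K b).equiv_apply i (N.descentBasis b) (.refl _)
      rw [Algebra.TensorProduct.basis_apply] at this
      exact this.trans (N.descentBasis_apply b i)
    have h1 : x ⊗ₜ[k] h = x • ((1 : K) ⊗ₜ[k] h) := by simp [TensorProduct.smul_tmul']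
    rw [h1, map_smul]
    exact congrArg _ (DFunLike.congr_fun this h)
  have key : ⇑(canonicalMap N.actionHom.toLinearMap) = N.action ∘ L := by
    ext t : 1
    induction t with
    | zero => simp
    | add x y hx hy => simp only [map_add, hx, hy, Function.comp_apply]
    | tmul x h =>
      rw [Function.comp_apply, hL]
      ext y
      simp [canonicalMap]
  rw [key]
  exact N.action_bijective.comp L.bijective

/-- The Hopf Galois structure associated to `N`. -/
noncomputable def hopfGaloisStructure : HopfGaloisStructure k K where
  H := N.fixedAlgebra
  μ := N.actionHom
  act_one h := (N.action_one_right h).trans (N.algebraMap_counitHom h).symm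
  act_mul h x y := by
    have key : ∀ t : N.fixedAlgebra ⊗[k] N.fixedAlgebra,
        LinearMap.mul' k K (TensorProduct.map (N.actionHom.toLinearMap.flip x)
          (N.actionHom.toLinearMap.flip y) t) =
        LinearMap.mul' K K (TensorProduct.map (N.actionAt x) (N.actionAt y) (N.tensorVal t)) := by
      intro t
      induction t with
      | zero => simp
      | add x y hx hy => simp only [map_add, hx, hy]
      | tmul a b => simp
    rw [key]
    refine (N.action_mul_right h x y).trans ?_
    exact congrArg (fun t => LinearMap.mul' K K (TensorProduct.map (N.actionAt x)
      (N.actionAt y) t)) (N.tensorVal_comulHom h).symm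
  bijective := N.canonicalMap_actionHom_bijective

theorem isGivenBy_hopfGaloisStructure : N.hopfGaloisStructure.IsGivenBy N := by
  refine ⟨AlgEquiv.refl, fun h => ?_, fun h => (N.algebraMap_counitHom h).symm, fun h => rfl,
    fun h x => N.action_apply h.1 x⟩
  exact (N.tensorVal_comulHom h).symm.trans (DFunLike.congr_fun N.tensorVal_toLinearMap _)

end RegularSubgroup

end Action

/-! ### Hopf Galois structures given by a regular subgroup -/

section GivenBy

variable {k K : Type*} [Field k] [Field K] [Algebra k K]

open MonoidAlgebra Coalgebra

/-- The data of `HopfGaloisStructure.IsGivenBy`: the embedding `S.H → K[N]`. -/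
structure HopfGaloisStructure.Embedding (S : HopfGaloisStructure k K)
    (N : RegularSubgroup (K ≃ₐ[k] K)) where
  /-- the isomorphism onto `K[N]^G` -/
  e : S.H ≃ₐ[k] N.fixedAlgebra
  /-- the embedding into `K[N]` -/
  j : S.H →ₐ[k] MonoidAlgebra K N.toSubgroup
  j_eq : ∀ h, j h = e h
  comul_j : ∀ h, comul (R := K) (j h) =
    tensorMap K j.toLinearMap j.toLinearMap (comul (R := k) h)
  counit_j : ∀ h, counit (R := K) (j h) = algebraMap k K (counit (R := k) h)
  antipode_j : ∀ h, HopfAlgebra.antipode K (j h) = j (HopfAlgebra.antipode k h)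
  act : ∀ h x, S.μ h x = N.action (j h) x

theorem HopfGaloisStructure.IsGivenBy.nonempty_embedding {S : HopfGaloisStructure k K}
    {N : RegularSubgroup (K ≃ₐ[k] K)} (h : S.IsGivenBy N) : Nonempty (S.Embedding N) := by
  obtain ⟨e, h1, h2, h3, h4⟩ := h
  exact ⟨⟨e, N.fixedAlgebra.val.comp e, fun _ => rfl, h1, h2, h3,
    fun h x => (h4 h x).trans (N.action_apply _ x).symm⟩⟩

namespace HopfGaloisStructure.Embedding

variable {S : HopfGaloisStructure k K} {N : RegularSubgroup (K ≃ₐ[k] K)} (E : S.Embedding N)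

theorem j_mem (h : S.H) : E.j h ∈ N.fixedAlgebra := by
  rw [E.j_eq]; exact (E.e h).2

theorem j_injective : Function.Injective E.j := by
  intro a b hab
  rw [E.j_eq, E.j_eq] at hab
  exact E.e.injective (Subtype.val_injective hab)

theorem exists_j_eq {v : MonoidAlgebra K N.toSubgroup} (hv : v ∈ N.fixedAlgebra) :
    ∃ h, E.j h = v := ⟨E.e.symm ⟨v, hv⟩, by simp [E.j_eq]⟩

/-- A group-like element of `S.H` is a fixed point of `G` in `N`. -/
theorem exists_single_of_isGroupLikeElem {h : S.H} (hh : IsGroupLikeElem k h) :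
    ∃ n : N.toSubgroup, E.j h = single n 1 ∧ ∀ g, N.conj g n = n := by
  have h1 : IsGroupLikeElem K (E.j h) :=
    ⟨by rw [E.counit_j, hh.counit_eq_one, map_one],
      by rw [E.comul_j, hh.comul_eq_tmul_self]; simp⟩
  obtain ⟨n, hn⟩ := isGroupLikeElem_iff_mem_range_single_one.1 h1
  refine ⟨n, hn.symm, fun g => ?_⟩
  have h2 := N.mem_fixedAlgebra.1 (E.j_mem h) g
  rw [← hn, N.galAct_single, map_one] at h2
  exact of_injective h2

variable [FiniteDimensional k K] [IsGalois k K]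

theorem linearIndependent_j_comp {ι : Type*} (b : Module.Basis ι k S.H) :
    LinearIndependent K (E.j.toLinearMap ∘ b) :=
  N.linearIndependent_of_mem_fixedAlgebra (fun _ => E.j_mem _)
    (b.linearIndependent.map' E.j.toLinearMap (LinearMap.ker_eq_bot.2 E.j_injective))

theorem tensorMap_j_injective :
    Function.Injective (tensorMap K E.j.toLinearMap E.j.toLinearMap) := by
  let b := Module.Free.chooseBasis k S.H
  exact injective_of_linearIndependent_comp_basis _ (b.tensorProduct b)
    (linearIndependent_tensorMap _ _ b b (E.linearIndependent_j_comp b)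
      (E.linearIndependent_j_comp b))

theorem isGroupLikeElem_of_j_eq {h : S.H} {n : N.toSubgroup} (hn : E.j h = single n 1) :
    IsGroupLikeElem k h where
  counit_eq_one := by
    apply (algebraMap k K).injective
    rw [← E.counit_j, hn]
    simp
  comul_eq_tmul_self := by
    apply E.tensorMap_j_injective
    rw [← E.comul_j, tensorMap_tmul]
    change _ = E.j h ⊗ₜ[K] E.j h
    rw [hn]
    simp

/-- If `G` fixes `N` pointwise, then `S` is the group algebra of `N` over `k`. -/
theorem exists_groupAlgebra_equiv {M : Type*} [Group M] (φ : M ≃* N.toSubgroup)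
    (hN : ∀ g n, N.conj g n = n) :
    ∃ f : MonoidAlgebra k M ≃ₐc[k] S.H, ∀ m, E.j (f (single m 1)) = single (φ m) 1 := by
  have hmem : ∀ n : N.toSubgroup, (single n 1 : MonoidAlgebra K N.toSubgroup) ∈ N.fixedAlgebra :=
    fun n => N.mem_fixedAlgebra.2 fun g => by simp [hN]
  choose u hu using fun n => E.exists_j_eq (hmem n)
  let F : M →* S.H :=
    { toFun := fun m => u (φ m)
      map_one' := E.j_injective (by rw [hu, map_one, map_one]; rfl)
      map_mul' := fun a b => E.j_injective (by
        rw [map_mul φ, hu, map_mul, hu, hu, single_mul_single, one_mul]) }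
  let f₀ : MonoidAlgebra k M →ₐ[k] S.H := lift k S.H M F
  have hf₀ : ∀ m, f₀ (single m 1) = u (φ m) := fun m => by simp [f₀, F]
  have hgl : ∀ n, IsGroupLikeElem k (u n) := fun n => E.isGroupLikeElem_of_j_eq (hu n)
  let f : MonoidAlgebra k M →ₐc[k] S.H := .ofAlgHom f₀
    (by ext m; simp [hf₀, (hgl _).counit_eq_one])
    (by ext m; simp [hf₀, (hgl _).comul_eq_tmul_self])
  have hf : ∀ x, f x = f₀ x := fun _ => rfl
  have hinj : Function.Injective f := by
    have h1 : LinearIndependent k ((E.j.comp f₀).toLinearMap ∘ MonoidAlgebra.basis M k) := by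
      have h2 : (E.j.comp f₀).toLinearMap ∘ MonoidAlgebra.basis M k =
          MonoidAlgebra.basis N.toSubgroup K ∘ φ := by
        ext m : 1
        simp [hf₀, hu]
      rw [h2]
      exact ((MonoidAlgebra.basis N.toSubgroup K).linearIndependent.comp _
        φ.injective).restrict_scalars' k
    exact Function.Injective.of_comp (f := E.j)
      (injective_of_linearIndependent_comp_basis (K := k) _ _ h1)
  -- Both dimensions equal $|N|$, so injectivity suffices.
  have hfin : Module.finrank k (MonoidAlgebra k M) = Module.finrank k S.H := by
    rw [Module.finrank_eq_nat_card_basis (MonoidAlgebra.basis M k), Nat.card_congr φ.toEquiv,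
      ← N.finrank_fixedAlgebra, E.e.toLinearEquiv.finrank_eq]
  have : Finite M := .of_equiv _ φ.symm.toEquiv
  have : Module.Finite k (MonoidAlgebra k M) := .of_basis (MonoidAlgebra.basis M k)
  have hsurj : Function.Surjective f :=
    (LinearMap.injective_iff_surjective_of_finrank_eq_finrank (f := f₀.toLinearMap) hfin).1 hinj
  refine ⟨.ofBijective f ⟨hinj, hsurj⟩, fun m => ?_⟩
  change E.j (f₀ _) = _
  rw [hf₀, hu]

end HopfGaloisStructure.Embedding

/-! ### Elements of $K[N]$ supported on a subgroup of $N$ -/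

namespace RegularSubgroup

variable (N : RegularSubgroup (K ≃ₐ[k] K)) (N' : Subgroup N.toSubgroup)

open Classical in
/-- The projection `K[N] → K[N]` onto the elements supported on a subgroup. -/
noncomputable def restrict :
    MonoidAlgebra K N.toSubgroup →ₗ[K] MonoidAlgebra K N.toSubgroup :=
  (MonoidAlgebra.basis N.toSubgroup K).constr K fun n => if n ∈ N' then single n 1 else 0

theorem restrict_single_of_mem {n : N.toSubgroup} (hn : n ∈ N') (a : K) :
    N.restrict N' (single n a) = single n a := by
  have h : single n a = a • MonoidAlgebra.basis N.toSubgroup K n := by simp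
  rw [h, map_smul, restrict, Module.Basis.constr_basis, if_pos hn]; rfl

theorem restrict_single_of_notMem {n : N.toSubgroup} (hn : n ∉ N') (a : K) :
    N.restrict N' (single n a) = 0 := by
  have h : single n a = a • MonoidAlgebra.basis N.toSubgroup K n := by simp
  rw [h, map_smul, restrict, Module.Basis.constr_basis, if_neg hn, smul_zero]

/-- The elements of `K[N]` supported on a subgroup, as a subalgebra. -/
noncomputable def supportedAlgebra : Subalgebra k (MonoidAlgebra K N.toSubgroup) :=
  (mapDomainAlgHom k K N'.subtype).range

theorem single_mem_supportedAlgebra {n : N.toSubgroup} (hn : n ∈ N') (a : K) :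
    single n a ∈ N.supportedAlgebra N' := ⟨single ⟨n, hn⟩ a, by simp⟩

theorem supportedAlgebra_induction {p : MonoidAlgebra K N.toSubgroup → Prop}
    (zero : p 0) (add : ∀ x y, p x → p y → p (x + y)) (single : ∀ n ∈ N', ∀ a, p (single n a))
    {v : MonoidAlgebra K N.toSubgroup} (hv : v ∈ N.supportedAlgebra N') : p v := by
  obtain ⟨w, rfl⟩ := hv
  induction w using MonoidAlgebra.induction_linear with
  | zero => simpa using zero
  | add x y hx hy => simpa only [map_add] using add _ _ hx hy
  | single n a => simpa using single n n.2 a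

theorem restrict_mem (v : MonoidAlgebra K N.toSubgroup) :
    N.restrict N' v ∈ N.supportedAlgebra N' := by
  induction v using MonoidAlgebra.induction_linear with
  | zero => rw [map_zero]; exact zero_mem _
  | add x y hx hy => rw [map_add]; exact add_mem hx hy
  | single n a =>
    by_cases hn : n ∈ N'
    · rw [restrict_single_of_mem N N' hn]; exact N.single_mem_supportedAlgebra N' hn a
    · rw [restrict_single_of_notMem N N' hn]; exact zero_mem _

/-- The complement of a $G$-stable subgroup is also $G$-stable, as $G$ acts by bijections. -/
theorem restrict_galAct (hN' : ∀ g, ∀ n ∈ N', N.conj g n ∈ N') (g : K ≃ₐ[k] K)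
    (v : MonoidAlgebra K N.toSubgroup) :
    N.restrict N' (N.galAct g v) = N.galAct g (N.restrict N' v) := by
  induction v using MonoidAlgebra.induction_linear with
  | zero => simp
  | add x y hx hy => simp only [map_add, hx, hy]
  | single n a =>
    by_cases hn : n ∈ N'
    · rw [restrict_single_of_mem N N' hn, galAct_single, restrict_single_of_mem N N' (hN' g n hn)]
    · have hn' : N.conj g n ∉ N' := fun h => hn (by
        have := hN' g⁻¹ _ h
        rwa [← conj_mul, inv_mul_cancel, conj_one] at this)
      rw [restrict_single_of_notMem N N' hn, galAct_single, restrict_single_of_notMem N N' hn',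
        map_zero]

theorem map_restrict_comul {v : MonoidAlgebra K N.toSubgroup} (hv : v ∈ N.supportedAlgebra N') :
    TensorProduct.map (N.restrict N') (N.restrict N') (comul (R := K) v) = comul (R := K) v := by
  refine N.supportedAlgebra_induction N' (p := fun v =>
    TensorProduct.map (N.restrict N') (N.restrict N') (comul (R := K) v) = comul (R := K) v)
    (by simp) (fun x y hx hy => by simp only [map_add, hx, hy])
    (fun n hn a => ?_) hv
  simp [restrict_single_of_mem N N' hn]

theorem antipode_mem_supportedAlgebra {v : MonoidAlgebra K N.toSubgroup}
    (hv : v ∈ N.supportedAlgebra N') : HopfAlgebra.antipode K v ∈ N.supportedAlgebra N' := by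
  refine N.supportedAlgebra_induction N' (p := fun v =>
    HopfAlgebra.antipode K v ∈ N.supportedAlgebra N')
    (by simp)
    (fun x y hx hy => by rw [map_add]; exact add_mem hx hy) (fun n hn a => ?_) hv
  rw [antipode_single]
  exact N.single_mem_supportedAlgebra N' (inv_mem hn) _

theorem action_eq_of_mem_supportedAlgebra {v : MonoidAlgebra K N.toSubgroup}
    (hv : v ∈ N.supportedAlgebra N') {x : K}
    (hx : ∀ n ∈ N', ((n : Equiv.Perm (K ≃ₐ[k] K))⁻¹ 1) x = x) :
    N.action v x = counit (R := K) v * x := by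
  refine N.supportedAlgebra_induction N' (p := fun v => N.action v x = counit (R := K) v * x)
    (by simp)
    (fun y z hy hz => by rw [map_add, LinearMap.add_apply, hy, hz, map_add, add_mul])
    (fun n hn a => ?_) hv
  rw [action_single, hx n hn]
  simp

end RegularSubgroup

/-! ### Sub-Hopf algebras from stable subgroups, and their fixed fields -/

namespace HopfGaloisStructure.Embedding

variable {S : HopfGaloisStructure k K} {N : RegularSubgroup (K ≃ₐ[k] K)} (E : S.Embedding N)
  (N' : Subgroup N.toSubgroup)

theorem exists_restrict (hN' : ∀ g, ∀ n ∈ N', N.conj g n ∈ N') (h : S.H) :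
    ∃ h', E.j h' = N.restrict N' (E.j h) :=
  E.exists_j_eq (N.mem_fixedAlgebra.2 fun g => by
    rw [← N.restrict_galAct N' hN', N.mem_fixedAlgebra.1 (E.j_mem h)])

variable [FiniteDimensional k K] [IsGalois k K]

/-- The sub-Hopf algebra `K[N']^G` for a `G`-stable subgroup `N'` of `N`. -/
noncomputable def subHopfAlgebra (hN' : ∀ g, ∀ n ∈ N', N.conj g n ∈ N') :
    SubHopfAlgebra k S.H where
  toSubalgebra := (N.supportedAlgebra N').comap E.j
  comul_mem' h hh := by
    choose p hp using E.exists_restrict N' hN'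
    -- `P` is the projection onto the subalgebra induced by `restrict`. Since $\Delta(h)$ is
    -- unchanged by $P \otimes P$, it comes from the tensor square of the subalgebra.
    let P : S.H →ₗ[k] (N.supportedAlgebra N').comap E.j :=
      { toFun := fun h => ⟨p h, by
          rw [Subalgebra.mem_comap, hp]; exact N.restrict_mem N' _⟩
        map_add' := fun a b => Subtype.ext (E.j_injective (by
          simp only [map_add, hp, Subalgebra.coe_add]))
        map_smul' := fun c a => Subtype.ext (E.j_injective (by
          have : N.restrict N' (c • E.j a) = c • N.restrict N' (E.j a) :=
            (N.restrict N').map_smul_of_tower c _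
          simp only [map_smul, hp, Subalgebra.coe_smul, RingHom.id_apply, this])) }
    refine ⟨TensorProduct.map P P (comul (R := k) h), ?_⟩
    apply E.tensorMap_j_injective
    have hP : ∀ a, E.j.toLinearMap ((((N.supportedAlgebra N').comap E.j).val.toLinearMap ∘ₗ P) a) =
        N.restrict N' (E.j.toLinearMap a) := hp
    rw [TensorProduct.map_map]
    refine (tensorMap_map hP hP _).trans ?_
    rw [← E.comul_j]
    exact N.map_restrict_comul N' hh
  antipode_mem' h hh := by
    change E.j _ ∈ N.supportedAlgebra N'
    rw [← E.antipode_j]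
    exact N.antipode_mem_supportedAlgebra N' hh

/-- A single $n \in N'$ need not lie in $K[N]^G$. But the defect `Φ`, precomposed with the
projection to $K[N']$, is $K$-linear and vanishes on $K[N]^G$, which spans $K[N]$; so it vanishes at
$n$. -/
theorem mem_fixedField_subHopfAlgebra (hN' : ∀ g, ∀ n ∈ N', N.conj g n ∈ N') (x : K) :
    x ∈ S.fixedField (E.subHopfAlgebra N' hN') ↔
      ∀ n ∈ N', ((n : Equiv.Perm (K ≃ₐ[k] K))⁻¹ 1) x = x := by
  have hdef : x ∈ S.fixedField (E.subHopfAlgebra N' hN') ↔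
      ∀ h, E.j h ∈ N.supportedAlgebra N' → S.μ h x = counit (R := k) h • x := Iff.rfl
  rw [hdef]
  constructor
  · intro H n hn
    let Φ : MonoidAlgebra K N.toSubgroup →ₗ[K] K :=
      (N.actionAt x - (counit (R := K)).smulRight x) ∘ₗ N.restrict N'
    have hΦ : Submodule.span K (N.fixedAlgebra : Set (MonoidAlgebra K N.toSubgroup)) ≤
        LinearMap.ker Φ := by
      rw [Submodule.span_le]
      intro v hv
      obtain ⟨h, rfl⟩ := E.exists_j_eq hv
      obtain ⟨h', hh'⟩ := E.exists_restrict N' hN' h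
      have := H h' (by rw [hh']; exact N.restrict_mem N' _)
      rw [E.act, ← algebraMap_smul K, ← E.counit_j, hh'] at this
      change Φ (E.j h) = 0
      simp [Φ, this]
    rw [N.span_fixedAlgebra] at hΦ
    have : Φ (single n 1) = 0 := hΦ trivial
    simpa [Φ, N.restrict_single_of_mem N' hn, sub_eq_zero] using this
  · intro H h hh
    rw [E.act, N.action_eq_of_mem_supportedAlgebra N' hh H, E.counit_j, Algebra.smul_def]

/-- `hsub` asks that each subgroup of $G$ be the image of a subgroup of $N$ under $n \mapsto
n^{-1}(1)$, which is a bijection but not a homomorphism in general. -/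
theorem galoisImage_eq_univ (E : S.Embedding N)
    (hN : ∀ N' : Subgroup N.toSubgroup, ∀ g, ∀ n ∈ N', N.conj g n ∈ N')
    (hsub : ∀ J : Subgroup (K ≃ₐ[k] K), ∃ N' : Subgroup N.toSubgroup,
      ∀ g, g ∈ J ↔ ∃ n ∈ N', (n : Equiv.Perm (K ≃ₐ[k] K))⁻¹ 1 = g) :
    S.galoisImage = Set.univ := by
  rw [Set.eq_univ_iff_forall]
  intro F
  obtain ⟨N', hN'⟩ := hsub F.fixingSubgroup
  refine ⟨E.subHopfAlgebra N' (hN N'), ?_⟩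
  ext x
  rw [mem_fixedField_subHopfAlgebra]
  conv_rhs => rw [← IsGalois.fixedField_fixingSubgroup F, IntermediateField.mem_fixedField_iff]
  constructor
  · intro H g hg
    obtain ⟨n, hn, rfl⟩ := (hN' g).1 hg
    exact H n hn
  · intro H n hn
    exact H _ ((hN' _).2 ⟨n, hn, rfl⟩)

end HopfGaloisStructure.Embedding

end GivenBy

/-! ### The subgroups `ρ(G)` and `λ(G)` -/

section Regular

variable {G : Type*} [Group G]

theorem leftReg_injective : Function.Injective (leftReg G) := by
  intro a b h
  simpa [leftReg] using DFunLike.congr_fun h 1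

theorem rightReg_injective : Function.Injective (rightReg G) := by
  intro a b h
  simpa [rightReg] using DFunLike.congr_fun h 1

variable (G) in
/-- The isomorphism `G ≃ λ(G)`. -/
noncomputable def lambdaEquiv : G ≃* (lambdaSubgroup G).toSubgroup :=
  MonoidHom.ofInjective leftReg_injective

variable (G) in
/-- The isomorphism `G ≃ ρ(G)`. -/
noncomputable def rhoEquiv : G ≃* (rhoSubgroup G).toSubgroup :=
  MonoidHom.ofInjective rightReg_injective

@[simp]
theorem coe_rhoEquiv (g : G) : (rhoEquiv G g : Equiv.Perm G) = rightReg G g := rfl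

theorem leftReg_inv_apply_one (g : G) : (leftReg G g)⁻¹ 1 = g⁻¹ := by
  rw [← map_inv]; simp [leftReg]

theorem rightReg_inv_apply_one (g : G) : (rightReg G g)⁻¹ 1 = g := by
  rw [← map_inv]; simp [rightReg]

theorem rhoSubgroup_conj (g : G) (n : (rhoSubgroup G).toSubgroup) :
    (rhoSubgroup G).conj g n = n := by
  obtain ⟨a, rfl⟩ := (rhoEquiv G).surjective n
  apply Subtype.ext
  change leftReg G g * rightReg G a * (leftReg G g)⁻¹ = rightReg G a
  rw [mul_inv_eq_iff_eq_mul]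
  ext x
  simp [leftReg, rightReg, mul_assoc]

theorem lambdaSubgroup_conj (g a : G) :
    (lambdaSubgroup G).conj g (lambdaEquiv G a) = lambdaEquiv G (g * a * g⁻¹) := by
  apply Subtype.ext
  change leftReg G g * leftReg G a * (leftReg G g)⁻¹ = leftReg G (g * a * g⁻¹)
  simp

theorem lambdaSubgroup_conj_eq_iff (g a : G) :
    (lambdaSubgroup G).conj g (lambdaEquiv G a) = lambdaEquiv G a ↔ g * a = a * g := by
  rw [lambdaSubgroup_conj, (lambdaEquiv G).injective.eq_iff, mul_inv_eq_iff_eq_mul]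

/-- $G$ acts trivially on $\rho(G)$ but not on $\lambda(G)$. -/
theorem not_gIsomorphic_rho_lambda (hG : ∃ a b : G, a * b ≠ b * a) :
    ¬ (rhoSubgroup G).GIsomorphic (lambdaSubgroup G) := by
  rintro ⟨φ, hφ⟩
  obtain ⟨a, b, hab⟩ := hG
  have h := hφ a (φ.symm (lambdaEquiv G b))
  rw [rhoSubgroup_conj, MulEquiv.apply_symm_apply] at h
  exact hab ((lambdaSubgroup_conj_eq_iff a b).1 h.symm)

theorem lambdaSubgroup_conj_mem (hG : ∀ H : Subgroup G, H.Normal)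
    (N' : Subgroup (lambdaSubgroup G).toSubgroup) (g : G) (n : (lambdaSubgroup G).toSubgroup)
    (hn : n ∈ N') : (lambdaSubgroup G).conj g n ∈ N' := by
  obtain ⟨a, rfl⟩ := (lambdaEquiv G).surjective n
  rw [lambdaSubgroup_conj]
  exact (hG (N'.comap (lambdaEquiv G).toMonoidHom)).conj_mem a hn g

end Regular

/-! ### The structures of $\rho(G)$ and $\lambda(G)$ compared -/

section Main

variable {k : Type*} {K : Type*} [Field k] [Field K] [Algebra k K] [FiniteDimensional k K]
  [IsGalois k K]

open MonoidAlgebra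

theorem exists_classical_equiv {S : HopfGaloisStructure k K}
    (hS : S.IsGivenBy (rhoSubgroup (K ≃ₐ[k] K))) :
    ∃ f : MonoidAlgebra k (K ≃ₐ[k] K) ≃ₐc[k] S.H,
      ∀ (a : MonoidAlgebra k (K ≃ₐ[k] K)) (x : K),
        S.μ (f a) x = a.coeff.sum fun g c => c • g x := by
  obtain ⟨E⟩ := hS.nonempty_embedding
  obtain ⟨f, hf⟩ := E.exists_groupAlgebra_equiv (rhoEquiv _) rhoSubgroup_conj
  refine ⟨f, fun a x => ?_⟩
  induction a using MonoidAlgebra.induction_linear with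
  | zero => simp
  | add a b ha hb =>
    rw [map_add, map_add, LinearMap.add_apply, ha, hb, coeff_add,
      Finsupp.sum_add_index' (by simp) (by simp [add_smul])]
  | single g c =>
    have h : single g c = c • single g (1 : k) := by simp
    rw [h, map_smul, map_smul, LinearMap.smul_apply, E.act, hf, RegularSubgroup.action_single,
      coe_rhoEquiv, rightReg_inv_apply_one, one_mul, ← h, coeff_single,
      Finsupp.sum_single_index (h := fun (g : K ≃ₐ[k] K) (c : k) => c • g x) (zero_smul _ _)]

/-- The Hopf algebras of the structures given by `ρ(G)` and `λ(G)` are not isomorphic if `G` is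
not abelian: only the first is generated by its group-like elements. -/
theorem isEmpty_bialgEquiv_of_not_comm (hG : ∃ a b : K ≃ₐ[k] K, a * b ≠ b * a)
    {S T : HopfGaloisStructure k K} (hS : S.IsGivenBy (rhoSubgroup (K ≃ₐ[k] K)))
    (hT : T.IsGivenBy (lambdaSubgroup (K ≃ₐ[k] K))) : IsEmpty (S.H ≃ₐc[k] T.H) := by
  refine ⟨fun F => ?_⟩
  obtain ⟨f, -⟩ := exists_classical_equiv hS
  obtain ⟨E⟩ := hT.nonempty_embedding
  have h1 : ∀ g : K ≃ₐ[k] K, IsGroupLikeElem k (F (f (single g 1))) := fun g =>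
    ((isGroupLikeElem_single_one g).map f).map F
  choose n hn hfix using fun g => E.exists_single_of_isGroupLikeElem (h1 g)
  have hinj : Function.Injective n := fun g h hgh => by
    have h2 := (hn g).trans ((congrArg (single · 1) hgh).trans (hn h).symm)
    exact of_injective (f.injective (F.injective (E.j_injective h2)))
  -- The $|G|$ group-likes of $k[G]$ exhaust $\lambda(G)$, so every $\lambda_b$ would be fixed by
  -- conjugation, making $G$ abelian.
  have hsurj := (Finite.injective_iff_surjective_of_equiv (lambdaEquiv _).toEquiv).1 hinj
  obtain ⟨a, b, hab⟩ := hG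
  obtain ⟨g, hg⟩ := hsurj (lambdaEquiv _ b)
  exact hab ((lambdaSubgroup_conj_eq_iff a b).1 (hg ▸ hfix g a))

theorem galoisImage_rho {S : HopfGaloisStructure k K}
    (hS : S.IsGivenBy (rhoSubgroup (K ≃ₐ[k] K))) : S.galoisImage = Set.univ := by
  obtain ⟨E⟩ := hS.nonempty_embedding
  refine E.galoisImage_eq_univ (fun N' g n hn => by rwa [rhoSubgroup_conj]) fun J =>
    ⟨J.map (rhoEquiv _).toMonoidHom, fun g => ?_⟩
  constructor
  · exact fun hg => ⟨_, ⟨g, hg, rfl⟩, rightReg_inv_apply_one g⟩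
  · rintro ⟨_, ⟨h, hh, rfl⟩, rfl⟩
    exact (rightReg_inv_apply_one h).symm ▸ hh

theorem galoisImage_lambda {S : HopfGaloisStructure k K}
    (hG : ∀ J : Subgroup (K ≃ₐ[k] K), J.Normal)
    (hS : S.IsGivenBy (lambdaSubgroup (K ≃ₐ[k] K))) : S.galoisImage = Set.univ := by
  obtain ⟨E⟩ := hS.nonempty_embedding
  refine E.galoisImage_eq_univ (lambdaSubgroup_conj_mem hG) fun J =>
    ⟨J.map (lambdaEquiv _).toMonoidHom, fun g => ?_⟩
  constructor
  -- The inverse appears because $\lambda_h^{-1}(1) = h^{-1}$, whereas $\rho_h^{-1}(1) = h$.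
  · exact fun hg => ⟨_, ⟨g⁻¹, inv_mem hg, rfl⟩,
      (leftReg_inv_apply_one g⁻¹).trans (inv_inv g)⟩
  · rintro ⟨_, ⟨h, hh, rfl⟩, rfl⟩
    exact (leftReg_inv_apply_one h).symm ▸ inv_mem hh

omit [FiniteDimensional k K] in
theorem isGalois_intermediateField (hG : ∀ J : Subgroup (K ≃ₐ[k] K), J.Normal)
    (F : IntermediateField k K) : IsGalois k F :=
  (InfiniteGalois.normal_iff_isGalois F).1 (hG _)

end Main

end HopfGalois


theorem mainTheorem3 (k : Type u) (K : Type v) [Field k] [Field K] [Algebra k K]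
    [FiniteDimensional k K] [IsGalois k K] (hG : IsHamiltonian (K ≃ₐ[k] K)) :
    -- `ρ(G)` and `λ(G)` are isomorphic (to `G`) but not `G`-isomorphic
    Nonempty ((K ≃ₐ[k] K) ≃* (rhoSubgroup (K ≃ₐ[k] K)).toSubgroup) ∧
    Nonempty ((K ≃ₐ[k] K) ≃* (lambdaSubgroup (K ≃ₐ[k] K)).toSubgroup) ∧
    Nonempty ((rhoSubgroup (K ≃ₐ[k] K)).toSubgroup ≃*
      (lambdaSubgroup (K ≃ₐ[k] K)).toSubgroup) ∧
    ¬ (rhoSubgroup (K ≃ₐ[k] K)).GIsomorphic (lambdaSubgroup (K ≃ₐ[k] K)) ∧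
    -- both give Hopf Galois structures on `K/k`
    (∃ S : HopfGaloisStructure.{v, u, v} k K, S.IsGivenBy (rhoSubgroup (K ≃ₐ[k] K))) ∧
    (∃ T : HopfGaloisStructure.{v, u, v} k K, T.IsGivenBy (lambdaSubgroup (K ≃ₐ[k] K))) ∧
    ∀ S T : HopfGaloisStructure.{w, u, v} k K,
      S.IsGivenBy (rhoSubgroup (K ≃ₐ[k] K)) → T.IsGivenBy (lambdaSubgroup (K ≃ₐ[k] K)) →
        -- the structure from `ρ(G)` is the classical one, on the group algebra `k[G]`
        (∃ f : MonoidAlgebra k (K ≃ₐ[k] K) ≃ₐc[k] S.H,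
          ∀ (a : MonoidAlgebra k (K ≃ₐ[k] K)) (x : K),
            S.μ (f a) x = a.coeff.sum fun g c => c • g x) ∧
        -- the two structures, and even their Hopf algebras, are not isomorphic
        ¬ S.Isomorphic T ∧
        IsEmpty (S.H ≃ₐc[k] T.H) ∧
        -- both Galois correspondences have all intermediate fields as image
        S.galoisImage = Set.univ ∧
        T.galoisImage = {E : IntermediateField k K | IsGalois k E} ∧
        T.galoisImage = Set.univ := by

  refine ⟨⟨rhoEquiv _⟩, ⟨lambdaEquiv _⟩, ⟨(rhoEquiv _).symm.trans (lambdaEquiv _)⟩,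
    not_gIsomorphic_rho_lambda hG.1, ⟨_, RegularSubgroup.isGivenBy_hopfGaloisStructure _⟩,
    ⟨_, RegularSubgroup.isGivenBy_hopfGaloisStructure _⟩, fun S T hS hT => ?_⟩
  have hempty := isEmpty_bialgEquiv_of_not_comm hG.1 hS hT
  refine ⟨exists_classical_equiv hS, fun ⟨F, _⟩ => hempty.false F, hempty,
    galoisImage_rho hS, ?_, galoisImage_lambda hG.2 hT⟩
  rw [galoisImage_lambda hG.2 hT, eq_comm, Set.eq_univ_iff_forall]
  exact isGalois_intermediateField hG.2
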